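/- **Setting.** Let $\mu,\nu$ be mutually absolutely continuous probability measures on $\mathbb R$ with $I_1=\int\log\frac{d\mu}{d\nu}\,d\mu$ and $I_0=-\int\log\frac{d\mu}{d\nu}\,d\nu$ both well defined and in $(0,\infty)$, and put $I=\min\{I_0,I_1\}$. There are $s$ sensors. In state $\theta\in\{0,1\}$ the true observations $x_i(k)$ ($1\le i\le s$, $k\ge1$) are i.i.d. with law $\nu$ if $\theta=0$ and $\mu$ if $\theta=1$. **Attack.** Let $s>2c$. An admissible attack $g$ consists, for each $\theta$, of a set $\mathcal C$ of $c$ compromised sensors (fixed over time) and of bias vectors $x^a(k)\in\mathbb R^s$, $k\ge1$, vanishing outside $\mathcal C$, where $x^a(k)$ is a measurable function of $\theta$, $k$, the true observations of the sensors in $\mathcal C$ up to time $k$, the earlier bias vectors, and possibly private randomness independent of all true observations. The fusion center receives $x'(k)=x(k)+x^a(k)$; $\mathbb P^g_\theta$, $\mathbb E^g_\theta$ refer to the law of $(x'(k))_{k\ge 1}$ in state $\theta$. **Voting rule.** For $a,b>0$ let $S_i(n)=\sum_{k=1}^n\log\frac{d\mu}{d\nu}(x'_i(k))$, $\tau_i^+=\inf\{k\ge1:S_i(k)\ge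 b\}$, $\tau_i^-=\inf\{k\ge1:S_i(k)\le -a\}$, and let $\tau^{\pm}_{(r)}$ be the $r$-th smallest of $\tau^{\pm}_1,\dots,\tau^{\pm}_s$. The rule $f^{(r)}$ stops at $T=\min\{\tau^-_{(r)},\tau^+_{(r)}\}$ and decides $0$ if $\tau^-_{(r)}<\tau^+_{(r)}$, $1$ if $\tau^+_{(r)}<\tau^-_{(r)}$, and $0$ or $1$ with probability $\frac12$ each if the two times are equal. Its error probabilities are $\alpha=\mathbb P^g_0[\text{decide }1]$ and $\beta=\mathbb P^g_1[\text{decide }0]$, and its worst-case delay is $D(T)=\max_{\theta}\mathbb E^g_\theta[T]$. **Theorem.** For every admissible attack $g$, the voting rule $f^*=f^{(s-c)}$ satisfies $$\gamma(f^*,g):=\liminf_{\alpha=\beta\to0^+}\frac{\log(1/\alpha)}{D(T)}\ \ge\ (s-2c)\,I ,$$ where the lower limit is over the thresholds $a,b>0$ for which $\alpha=\beta$ (and is $+\infty$ if there are none with arbitrarily small $\alpha=\beta>0$). Moreover, with equal thresholds $a=b\to\infty$ one has $\alpha\to0$, $\beta\to0$ and $$\liminf_{a=b\to\infty}\frac{\log(1/\max\{\alpha,\beta\})}{D(T)}\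 \ge\ (s-2c)\,I .$$ -/

import Mathlib

open MeasureTheory Filter Topology
open scoped ENNReal

namespace ByzDet

/-! ## Sampling model

There are `s` sensors, indexed by `Fin s`. Observation `k : ℕ` of a sequence is the one taken at
time `k + 1`, so a quantity "at time `k`" depends on the observations with index `< k`.
The state `θ` lives in `Fin 2`; `ν` is the law of one observation for `θ = 0` and `μ` for
`θ = 1`. -/

/-- Law of a single observation in state `θ`. -/
noncomputable def obsLaw (μ ν : Measure ℝ) (θ : Fin 2) : Measure ℝ := if θ = 0 then ν else μ

/-- Law of all true observations `x_i(k)`: independent and identically distributed over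
time and sensors. -/
noncomputable def trueLaw (μ ν : Measure ℝ) (s : ℕ) (θ : Fin 2) : Measure (ℕ × Fin s → ℝ) :=
  Measure.infinitePi fun _ => obsLaw μ ν θ

/-- Kullback-Leibler divergence `I₁ = ∫ log (dμ/dν) dμ`. -/
noncomputable def klOne (μ ν : Measure ℝ) : ℝ := ∫ x, llr μ ν x ∂μ

/-- Kullback-Leibler divergence `I₀ = -∫ log (dμ/dν) dν`. -/
noncomputable def klZero (μ ν : Measure ℝ) : ℝ := -∫ x, llr μ ν x ∂ν

/-! ## Attacks -/

/-- An attack strategy on `c` of the `s` sensors, with private randomness in `Ξ`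
(`Ξ = Unit` gives the deterministic strategies). In state `θ`, the bias vector at time `k + 1` is a
measurable function of the private randomness, of the true observations of the compromised sensors
up to time `k + 1` and of the bias vectors up to time `k`; it vanishes at all honest sensors. -/
structure Attack (s c : ℕ) (Ξ : Type*) [MeasurableSpace Ξ] where
  /-- the set of compromised sensors, fixed over time -/
  comp : Fin 2 → Finset (Fin s)
  card_comp : ∀ θ, (comp θ).card = c
  /-- the bias vector as a function of the attacker's information -/
  strat : (θ : Fin 2) → (k : ℕ) →
    Ξ × (Fin (k + 1) → comp θ → ℝ) × (Fin k → Fin s → ℝ) → Fin s → ℝ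
  measurable_strat : ∀ θ k, Measurable (strat θ k)
  honest : ∀ θ k z, ∀ i ∉ comp θ, strat θ k z i = 0

/-- The bias vectors `x^a` that the attack produces, given the private randomness `ξ` and the true
observations `x`. -/
noncomputable def Attack.bias {s c : ℕ} {Ξ : Type*} [MeasurableSpace Ξ] (g : Attack s c Ξ)
    (θ : Fin 2) (ξ : Ξ) (x : ℕ × Fin s → ℝ) (k : ℕ) : Fin s → ℝ :=
  g.strat θ k (ξ, (fun j i => x (j, i)), fun j => g.bias θ ξ x j)
termination_by k
decreasing_by exact j.isLt

/-- The manipulated observations `x' = x + x^a` received by the fusion center. -/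
noncomputable def Attack.manip {s c : ℕ} {Ξ : Type*} [MeasurableSpace Ξ] (g : Attack s c Ξ)
    (θ : Fin 2) (z : Ξ × (ℕ × Fin s → ℝ)) : ℕ → Fin s → ℝ :=
  fun k i => z.2 (k, i) + g.bias θ z.1 z.2 k i

theorem Attack.measurable_bias {s c : ℕ} {Ξ : Type*} [MeasurableSpace Ξ] (g : Attack s c Ξ)
    (θ : Fin 2) (k : ℕ) :
    Measurable fun z : Ξ × (ℕ × Fin s → ℝ) => g.bias θ z.1 z.2 k := by
  induction k using Nat.strong_induction_on with
  | _ k ih =>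
    have h : (fun z : Ξ × (ℕ × Fin s → ℝ) => g.bias θ z.1 z.2 k) = fun z =>
        g.strat θ k (z.1, (fun j i => z.2 (j, i)), fun j : Fin k => g.bias θ z.1 z.2 j) := by
      funext z
      rw [Attack.bias]
    rw [h]
    refine (g.measurable_strat θ k).comp (measurable_fst.prodMk (Measurable.prodMk ?_ ?_))
    · fun_prop
    · exact measurable_pi_lambda _ fun j => ih j j.isLt

theorem Attack.measurable_manip {s c : ℕ} {Ξ : Type*} [MeasurableSpace Ξ] (g : Attack s c Ξ)
    (θ : Fin 2) : Measurable (g.manip θ) := by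
  refine measurable_pi_lambda _ fun k => measurable_pi_lambda _ fun i => ?_
  have h := (measurable_pi_apply i).comp (g.measurable_bias θ k)
  exact (by fun_prop : Measurable fun z : Ξ × (ℕ × Fin s → ℝ) => z.2 (k, i)).add h

/-- `P_θ^g`, the law of the manipulated observations in state `θ`; the private randomness has
law `ρ` and is independent of the true observations. -/
noncomputable def attackedLaw {s c : ℕ} {Ξ : Type*} [MeasurableSpace Ξ] (μ ν : Measure ℝ)
    (ρ : Measure Ξ) (g : Attack s c Ξ) (θ : Fin 2) : Measure (ℕ → Fin s → ℝ) :=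
  (ρ.prod (trueLaw μ ν s θ)).map (g.manip θ)

/-! ## Sequential detectors -/

/-- The first time `k ≥ 1` at which `p` holds, `⊤` if there is none. -/
noncomputable def firstTime (p : ℕ → Prop) : ℕ∞ := ⨅ (k : ℕ) (_ : 1 ≤ k ∧ p k), (k : ℕ∞)

/-- A sequential detector. At each time `k ≥ 1` it looks at the observations up to time `k` and
either continues (`none`) or stops (`some p`) and then decides for hypothesis 1 with
probability `p` and for hypothesis 0 with probability `1 - p`. So `some 0`, `some 1` are the
decisions 0, 1, and `some (1/2)` is a fair coin toss. -/
structure Detector (s : ℕ) where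
  rule : ℕ → (ℕ → Fin s → ℝ) → Option unitInterval
  adapted : ∀ k x y, (∀ j < k, x j = y j) → rule k x = rule k y
  measurable_rule : ∀ k, ∀ B : Set unitInterval, MeasurableSet B →
    MeasurableSet {x | ∃ p ∈ B, rule k x = some p}

/-- The stopping time `T` of a detector. -/
noncomputable def Detector.stopTime {s : ℕ} (f : Detector s) (x : ℕ → Fin s → ℝ) : ℕ∞ :=
  firstTime fun k => f.rule k x ≠ none

open Classical in
/-- Conditional probability, given the received observations, that the detector stops and decides
for the hypothesis `h`. -/
noncomputable def Detector.decisionProb {s : ℕ} (f : Detector s) (h : Fin 2)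
    (x : ℕ → Fin s → ℝ) : ℝ≥0∞ :=
  if f.stopTime x = ⊤ then 0
  else match f.rule (f.stopTime x).toNat x with
    | none => 0
    | some p => ENNReal.ofReal (if h = 0 then 1 - (p : ℝ) else (p : ℝ))

/-- Type-I error probability `α = P_0^g[f_T = 1]`. -/
noncomputable def typeI {s c : ℕ} {Ξ : Type*} [MeasurableSpace Ξ] (μ ν : Measure ℝ)
    (ρ : Measure Ξ) (g : Attack s c Ξ) (f : Detector s) : ℝ≥0∞ :=
  ∫⁻ x, f.decisionProb 1 x ∂(attackedLaw μ ν ρ g 0)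

/-- Type-II error probability `β = P_1^g[f_T = 0]`. -/
noncomputable def typeII {s c : ℕ} {Ξ : Type*} [MeasurableSpace Ξ] (μ ν : Measure ℝ)
    (ρ : Measure Ξ) (g : Attack s c Ξ) (f : Detector s) : ℝ≥0∞ :=
  ∫⁻ x, f.decisionProb 0 x ∂(attackedLaw μ ν ρ g 1)

/-- Worst-case detection delay `D(T) = max_θ E_θ^g[T]`. -/
noncomputable def delay {s c : ℕ} {Ξ : Type*} [MeasurableSpace Ξ] (μ ν : Measure ℝ)
    (ρ : Measure Ξ) (g : Attack s c Ξ) (f : Detector s) : ℝ≥0∞ :=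
  ⨆ θ : Fin 2, ∫⁻ x, ((f.stopTime x : ℕ∞) : ℝ≥0∞) ∂(attackedLaw μ ν ρ g θ)

/-- The quotient `log (1/p) / D`. -/
noncomputable def logRatio (p D : ℝ≥0∞) : EReal := ENNReal.log p⁻¹ / (D : EReal)

/-- The performance `γ(f, g)`, the lower limit of `log (1/α) / D(T)` as `α = β → 0⁺`. Here `f` is
a family of detectors with thresholds `-a < 0 < b`, and the limit is taken over the
thresholds for which `α = β`. -/
noncomputable def gamma {s c : ℕ} {Ξ : Type*} [MeasurableSpace Ξ] (μ ν : Measure ℝ)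
    (ρ : Measure Ξ) (g : Attack s c Ξ) (f : ℝ → ℝ → Detector s) : EReal :=
  liminf (fun t : ℝ × ℝ =>
      logRatio (typeI μ ν ρ g (f t.1 t.2)) (delay μ ν ρ g (f t.1 t.2)))
    (comap (fun t : ℝ × ℝ => typeI μ ν ρ g (f t.1 t.2)) (𝓝[>] 0) ⊓
      𝓟 {t : ℝ × ℝ | 0 < t.1 ∧ 0 < t.2 ∧
        typeI μ ν ρ g (f t.1 t.2) = typeII μ ν ρ g (f t.1 t.2)})

/-- The performance along equal thresholds: the lower limit of `log (1/max α β) / D(T)` as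
`a = b → ∞`. -/
noncomputable def gammaEqualThresholds {s c : ℕ} {Ξ : Type*} [MeasurableSpace Ξ]
    (μ ν : Measure ℝ) (ρ : Measure Ξ) (g : Attack s c Ξ) (f : ℝ → ℝ → Detector s) : EReal :=
  liminf (fun a : ℝ =>
      logRatio (max (typeI μ ν ρ g (f a a)) (typeII μ ν ρ g (f a a))) (delay μ ν ρ g (f a a)))
    atTop

/-! ## The voting rule -/

/-- Cumulative log-likelihood ratio `S_i(n)` of sensor `i`, computed from the received
observations. -/
noncomputable def cumLLR (μ ν : Measure ℝ) {s : ℕ} (x : ℕ → Fin s → ℝ) (i : Fin s) (n : ℕ) : ℝ :=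
  ∑ k ∈ Finset.range n, llr μ ν (x k i)

/-- `τ⁺_i(b)`, the first time that `S_i ≥ b`. -/
noncomputable def tauPlus (μ ν : Measure ℝ) {s : ℕ} (b : ℝ) (x : ℕ → Fin s → ℝ)
    (i : Fin s) : ℕ∞ :=
  firstTime fun k => b ≤ cumLLR μ ν x i k

/-- `τ⁻_i(a)`, the first time that `S_i ≤ -a`. -/
noncomputable def tauMinus (μ ν : Measure ℝ) {s : ℕ} (a : ℝ) (x : ℕ → Fin s → ℝ)
    (i : Fin s) : ℕ∞ :=
  firstTime fun k => cumLLR μ ν x i k ≤ -a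

/-- The `r`-th smallest (`1 ≤ r ≤ s`) of the times `τ_1, …, τ_s`, that is, the least `t` such
that at least `r` of them are `≤ t`. -/
noncomputable def orderStat {s : ℕ} (τ : Fin s → ℕ∞) (r : ℕ) : ℕ∞ :=
  sInf {t : ℕ∞ | r ≤ (Finset.univ.filter fun i => τ i ≤ t).card}

open Classical in
/-- The decision at time `k` when `m = τ⁻_(r)` and `p = τ⁺_(r)`: continue while `k < min m p`; then
decide 0 if `m < p`, 1 if `p < m`, and toss a fair coin if `m = p`. -/
noncomputable def voteDecision (m p : ℕ∞) (k : ℕ) : Option unitInterval :=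
  if (k : ℕ∞) < min m p then none
  else if m < p then some 0
  else if p < m then some 1
  else some ⟨1 / 2, by norm_num, by norm_num⟩

theorem firstTime_le_iff (p : ℕ → Prop) (n : ℕ) :
    firstTime p ≤ n ↔ ∃ k, 1 ≤ k ∧ k ≤ n ∧ p k := by
  rw [← not_lt, firstTime]
  constructor
  · intro h
    by_contra! hc
    refine h (lt_of_lt_of_le (b := ((n + 1 : ℕ) : ℕ∞)) (by exact_mod_cast Nat.lt_succ_self n) ?_)
    refine le_iInf₂ fun k hk => ?_
    by_contra hlt
    exact hc k hk.1 (by have : k < n + 1 := by exact_mod_cast not_le.mp hlt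
                        omega) hk.2
  · rintro ⟨k, h1, hkn, hp⟩ h
    have := lt_of_lt_of_le h (iInf₂_le k ⟨h1, hp⟩)
    exact absurd hkn (not_le.mpr (by exact_mod_cast this))

theorem orderStat_le_iff {s : ℕ} (τ : Fin s → ℕ∞) (r n : ℕ) :
    orderStat τ r ≤ n ↔ r ≤ (Finset.univ.filter fun i => τ i ≤ n).card := by
  constructor
  · intro h
    have hne : {t : ℕ∞ | r ≤ (Finset.univ.filter fun i => τ i ≤ t).card}.Nonempty := by
      by_contra hc
      rw [Set.not_nonempty_iff_eq_empty] at hc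
      rw [orderStat, hc, sInf_empty] at h
      exact absurd h (by simp)
    refine (csInf_mem hne).trans (Finset.card_le_card fun i => ?_)
    simp only [Finset.mem_filter, Finset.mem_univ, true_and]
    exact fun hi => hi.trans h
  · exact fun h => sInf_le h

theorem voteDecision_congr {m m' p p' : ℕ∞} {k : ℕ} (hm : ∀ n ≤ k, m ≤ (n : ℕ) ↔ m' ≤ (n : ℕ))
    (hp : ∀ n ≤ k, p ≤ (n : ℕ) ↔ p' ≤ (n : ℕ)) : voteDecision m p k = voteDecision m' p' k := by
  have key : ∀ u u' : ℕ∞, (∀ n ≤ k, u ≤ (n : ℕ) ↔ u' ≤ (n : ℕ)) →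
      u = u' ∨ ((k : ℕ∞) < u ∧ (k : ℕ∞) < u') := by
    intro u u' h
    by_cases hu : u ≤ k
    · left
      have hu' := (h k le_rfl).1 hu
      lift u to ℕ using ne_top_of_le_ne_top (ENat.natCast_ne_top k) hu
      lift u' to ℕ using ne_top_of_le_ne_top (ENat.natCast_ne_top k) hu'
      exact le_antisymm ((h u' (by exact_mod_cast hu')).2 le_rfl)
        ((h u (by exact_mod_cast hu)).1 le_rfl)
    · exact Or.inr ⟨not_le.mp hu, not_le.mp fun h' => hu ((h k le_rfl).2 h')⟩
  rcases key m m' hm with rfl | ⟨h1, h2⟩ <;> rcases key p p' hp with rfl | ⟨h3, h4⟩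
  · rfl
  · by_cases hk : (k : ℕ∞) < m
    · simp [voteDecision, hk, h3, h4]
    · have hk' := not_lt.mp hk
      simp [voteDecision, hk, hk'.trans_lt h3, hk'.trans_lt h4]
  · by_cases hk : (k : ℕ∞) < p
    · simp [voteDecision, hk, h1, h2]
    · have hk' := not_lt.mp hk
      simp [voteDecision, hk, hk'.trans_lt h1, hk'.trans_lt h2, (hk'.trans_lt h1).not_gt,
        (hk'.trans_lt h2).not_gt]
  · simp [voteDecision, h1, h2, h3, h4]

theorem cumLLR_congr (μ ν : Measure ℝ) {s : ℕ} {x y : ℕ → Fin s → ℝ} {k : ℕ}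
    (h : ∀ j < k, x j = y j) (i : Fin s) {n : ℕ} (hn : n ≤ k) :
    cumLLR μ ν x i n = cumLLR μ ν y i n := by
  refine Finset.sum_congr rfl fun j hj => ?_
  rw [h j ((Finset.mem_range.mp hj).trans_le hn)]

theorem measurable_cumLLR (μ ν : Measure ℝ) {s : ℕ} (i : Fin s) (n : ℕ) :
    Measurable fun x : ℕ → Fin s → ℝ => cumLLR μ ν x i n := by
  refine Finset.measurable_sum _ fun k _ => (measurable_llr μ ν).comp ?_
  fun_prop

theorem measurable_enat_of_le {Ω : Type*} [MeasurableSpace Ω] {τ : Ω → ℕ∞}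
    (h : ∀ n : ℕ, MeasurableSet {x | τ x ≤ n}) : Measurable τ := by
  have hfin : ∀ n : ℕ, MeasurableSet (τ ⁻¹' {(n : ℕ∞)}) := by
    intro n
    have : τ ⁻¹' {(n : ℕ∞)} = {x | τ x ≤ n} \ ⋃ m : Fin n, {x | τ x ≤ ((m : ℕ) : ℕ∞)} := by
      ext x
      simp only [Set.mem_preimage, Set.mem_singleton_iff, Set.mem_sdiff, Set.mem_ofPred_eq,
        Set.mem_iUnion, not_exists]
      constructor
      · intro hx
        exact ⟨hx.le, fun m hm => absurd m.isLt (by rw [hx] at hm; exact not_lt.mpr (by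
          exact_mod_cast hm))⟩
      · rintro ⟨h1, h2⟩
        generalize hu : τ x = u at h1 h2
        lift u to ℕ using ne_top_of_le_ne_top (ENat.natCast_ne_top n) h1
        have h1' : u ≤ n := by exact_mod_cast h1
        rcases h1'.lt_or_eq with hlt | rfl
        · exact absurd le_rfl (h2 ⟨u, hlt⟩)
        · rfl
    rw [this]
    exact (h n).diff (MeasurableSet.iUnion fun m => h m)
  refine measurable_to_countable' fun t => ?_
  induction t using ENat.recTopCoe with
  | coe n => exact hfin n
  | top =>
    have : τ ⁻¹' {⊤} = (⋃ n : ℕ, {x | τ x ≤ n})ᶜ := by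
      ext x
      simp only [Set.mem_preimage, Set.mem_singleton_iff, Set.mem_compl_iff, Set.mem_iUnion,
        Set.mem_ofPred_eq, not_exists]
      constructor
      · intro hx n
        simp [hx]
      · intro hx
        by_contra hne
        exact hx (τ x).toNat (ENat.natCast_toNat hne).ge
    rw [this]
    exact (MeasurableSet.iUnion h).compl

theorem measurable_firstTime {Ω : Type*} [MeasurableSpace Ω] {p : Ω → ℕ → Prop}
    (h : ∀ n, MeasurableSet {x | p x n}) : Measurable fun x => firstTime (p x) := by
  refine measurable_enat_of_le fun n => ?_
  have : {x | firstTime (p x) ≤ n} = ⋃ k : ℕ, {x | 1 ≤ k ∧ k ≤ n ∧ p x k} := by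
    ext x
    simp [firstTime_le_iff]
  rw [this]
  exact MeasurableSet.iUnion fun k =>
    (MeasurableSet.const _).inter ((MeasurableSet.const _).inter (h k))

theorem measurable_orderStat {Ω : Type*} [MeasurableSpace Ω] {s : ℕ} {τ : Ω → Fin s → ℕ∞}
    (h : ∀ i, Measurable fun x => τ x i) (r : ℕ) : Measurable fun x => orderStat (τ x) r :=
  (Measurable.of_discrete (f := fun t : Fin s → ℕ∞ => orderStat t r)).comp
    (measurable_pi_lambda _ h)

/-- The voting rule `f^(r)` with thresholds `-a` and `b`. -/
noncomputable def votingRule (μ ν : Measure ℝ) (s r : ℕ) (a b : ℝ) : Detector s where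
  rule k x := voteDecision (orderStat (tauMinus μ ν a x) r) (orderStat (tauPlus μ ν b x) r) k
  adapted k x y h := by
    refine voteDecision_congr (fun n hn => ?_) fun n hn => ?_
    · have : ∀ i, tauMinus μ ν a x i ≤ n ↔ tauMinus μ ν a y i ≤ n := fun i => by
        simp only [tauMinus, firstTime_le_iff]
        refine exists_congr fun j => and_congr_right fun _ => and_congr_right fun hj => ?_
        rw [cumLLR_congr μ ν h i (hj.trans hn)]
      simp only [orderStat_le_iff, this]
    · have : ∀ i, tauPlus μ ν b x i ≤ n ↔ tauPlus μ ν b y i ≤ n := fun i => by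
        simp only [tauPlus, firstTime_le_iff]
        refine exists_congr fun j => and_congr_right fun _ => and_congr_right fun hj => ?_
        rw [cumLLR_congr μ ν h i (hj.trans hn)]
      simp only [orderStat_le_iff, this]
  measurable_rule k B _ := by
    have hm : Measurable fun x : ℕ → Fin s → ℝ => orderStat (tauMinus μ ν a x) r :=
      measurable_orderStat (fun i => measurable_firstTime fun n =>
        measurableSet_le (measurable_cumLLR μ ν i n) measurable_const) r
    have hp : Measurable fun x : ℕ → Fin s → ℝ => orderStat (tauPlus μ ν b x) r :=
      measurable_orderStat (fun i => measurable_firstTime fun n =>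
        measurableSet_le measurable_const (measurable_cumLLR μ ν i n)) r
    exact (hm.prodMk hp) (Set.to_countable
      {t : ℕ∞ × ℕ∞ | ∃ q ∈ B, voteDecision t.1 t.2 k = some q}).measurableSet

end ByzDet

namespace ByzDet

/-! An attack cannot touch the honest sensors, so everything is bounded through their true
log-likelihood walks, oriented so that the drift is positive in the true state. A wrong decision
needs `s - c` sensors at the wrong threshold, hence at least `s - 2c` honest ones. These are
independent, and each ever falls to `-y` with probability at most a constant times `exp (-t y)`, for
any `t < 1`. So `α ≤ C exp (-t (s - 2c) b)` and `β ≤ C exp (-t (s - 2c) a)`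
(`attackedLaw_orderStat_ne_top_le`). Conversely, the `s - c` honest sensors alone suffice to stop
the rule. Each walk is above `y` from time about `y / J` on, up to geometric tails, for any `J < I`,
so `D(T) ≤ max a b / J + D₀` (`lintegral_stopTime_le`). When `α = β`, the common value obeys both
error bounds, hence the one with exponent `max a b`, which also governs the delay. The ratio is then
asymptotically at least `t (s - 2c) J`; letting `t → 1` and `J → I` gives the claim
(`exists_error_bounds`). -/

open ProbabilityTheory

/-! ### Exponential moments of a log-likelihood increment -/

/-- `L` behaves under `P` like the log-likelihood ratio of `P` against an equivalent
probability measure at positive Kullback-Leibler divergence. -/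
structure IsLLRIncrement (P : Measure ℝ) (L : ℝ → ℝ) : Prop where
  measurable : Measurable L
  integrable : Integrable L P
  integral_pos : 0 < ∫ x, L x ∂P
  integrable_exp_neg : Integrable (fun x => Real.exp (-L x)) P
  integral_exp_neg : ∫ x, Real.exp (-L x) ∂P = 1

/-- Convexity of `exp` between `0` and `u`. With `u = -L x` it dominates the moments of order `t ∈
[0, 1]` by the integrable `exp (-L)`. -/
theorem exp_mul_le_chord {t : ℝ} (ht0 : 0 ≤ t) (ht1 : t ≤ 1) (u : ℝ) :
    Real.exp (t * u) ≤ 1 - t + t * Real.exp u := by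
  have h := convexOn_exp.2 (Set.mem_univ (0 : ℝ)) (Set.mem_univ u) (sub_nonneg.2 ht1) ht0
    (by ring)
  simpa using h

theorem exp_mul_lt_chord {t : ℝ} (ht0 : 0 < t) (ht1 : t < 1) {u : ℝ} (hu : u ≠ 0) :
    Real.exp (t * u) < 1 - t + t * Real.exp u := by
  have h := strictConvexOn_exp.2 (Set.mem_univ (0 : ℝ)) (Set.mem_univ u) hu.symm
    (sub_pos.2 ht1) ht0 (by ring)
  simpa using h

namespace IsLLRIncrement

variable {P : Measure ℝ} [IsProbabilityMeasure P] {L : ℝ → ℝ}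

theorem integrable_exp_mul (h : IsLLRIncrement P L) {t : ℝ} (ht0 : 0 ≤ t) (ht1 : t ≤ 1) :
    Integrable (fun x => Real.exp (-t * L x)) P := by
  have hb : Integrable (fun x => 1 - t + t * Real.exp (-L x)) P :=
    (integrable_const _).add (h.integrable_exp_neg.const_mul t)
  refine hb.mono' ?_ (.of_forall fun x => ?_)
  · exact (Real.measurable_exp.comp (h.measurable.const_mul (-t))).aestronglyMeasurable
  · rw [Real.norm_eq_abs, Real.abs_exp]
    have := exp_mul_le_chord ht0 ht1 (-L x)
    rwa [show t * -L x = -t * L x by ring] at this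

/-- The chord with `u = -L` integrates to exactly `1`. Equality would force `L = 0` almost
everywhere by strict convexity, against the positive mean. -/
theorem mgf_lt_one (h : IsLLRIncrement P L) {t : ℝ} (ht0 : 0 < t) (ht1 : t < 1) :
    mgf L P (-t) < 1 := by
  have hint := h.integrable_exp_mul ht0.le ht1.le
  have hint' : Integrable (fun x => 1 - t + t * Real.exp (-L x)) P :=
    (integrable_const _).add (h.integrable_exp_neg.const_mul t)
  have hnn : 0 ≤ fun x => (1 - t + t * Real.exp (-L x)) - Real.exp (-t * L x) := fun x => by
    have := exp_mul_le_chord ht0.le ht1.le (-L x)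
    rw [show t * -L x = -t * L x by ring] at this
    exact sub_nonneg.2 this
  have hval : ∫ x, ((1 - t + t * Real.exp (-L x)) - Real.exp (-t * L x)) ∂P
      = 1 - mgf L P (-t) := by
    rw [integral_sub hint' hint, integral_add (integrable_const _)
      (h.integrable_exp_neg.const_mul t), integral_const_mul, h.integral_exp_neg, mgf]
    simp
  by_contra hge
  have h0 : ∫ x, ((1 - t + t * Real.exp (-L x)) - Real.exp (-t * L x)) ∂P = 0 :=
    le_antisymm (by rw [hval]; linarith [not_lt.1 hge]) (integral_nonneg hnn)
  rw [integral_eq_zero_iff_of_nonneg hnn (hint'.sub hint)] at h0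
  have hL : L =ᵐ[P] 0 := by
    filter_upwards [h0] with x hx
    by_contra hne
    have hlt := exp_mul_lt_chord ht0 ht1 (neg_ne_zero.2 hne)
    rw [show t * -L x = -t * L x by ring] at hlt
    exact (sub_pos.2 hlt).ne' hx
  have := h.integral_pos
  rw [integral_congr_ae hL] at this
  simp at this

/-- Differentiation under the integral at `0`, only from the right since moments are controlled on
one side only. The tangent at `0` bounds the quotient above by `L`, the chord bounds it below by `1
- exp (-L)`. -/
theorem tendsto_mgf_slope (h : IsLLRIncrement P L) :
    Tendsto (fun t : ℝ => (1 - mgf L P (-t)) / t) (𝓝[>] 0) (𝓝 (∫ x, L x ∂P)) := by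
  have hmem : ∀ᶠ t : ℝ in 𝓝[>] 0, t ∈ Set.Ioo (0 : ℝ) 1 := Ioo_mem_nhdsGT one_pos
  have key : Tendsto (fun t : ℝ => ∫ x, (1 - Real.exp (-t * L x)) / t ∂P) (𝓝[>] 0)
      (𝓝 (∫ x, L x ∂P)) := by
    refine tendsto_integral_filter_of_dominated_convergence
      (fun x => |L x| + Real.exp (-L x)) ?_ ?_ (h.integrable.abs.add h.integrable_exp_neg) ?_
    · refine .of_forall fun t => Measurable.aestronglyMeasurable ?_
      exact (measurable_const.sub (Real.measurable_exp.comp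
        (h.measurable.const_mul (-t)))).div_const t
    · filter_upwards [hmem] with t ht
      refine .of_forall fun x => ?_
      have h1 := exp_mul_le_chord ht.1.le ht.2.le (-L x)
      have h2 := Real.add_one_le_exp (-t * L x)
      rw [show t * -L x = -t * L x by ring] at h1
      have h3 := le_abs_self (L x)
      have h4 := Real.exp_pos (-L x)
      have h5 := abs_nonneg (L x)
      rw [Real.norm_eq_abs, abs_le, le_div_iff₀ ht.1, div_le_iff₀ ht.1]
      constructor <;> nlinarith [ht.1, mul_nonneg ht.1.le h5, mul_pos ht.1 h4,
        mul_le_mul_of_nonneg_left h3 ht.1.le]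
    · refine .of_forall fun x => ?_
      have hd : HasDerivAt (fun t : ℝ => 1 - Real.exp (-t * L x)) (L x) 0 := by
        have := (((hasDerivAt_id (0 : ℝ)).neg.mul_const (L x)).exp).const_sub 1
        simpa using this
      have hs := hasDerivWithinAt_iff_tendsto_slope.1 (hd.hasDerivWithinAt (s := Set.Ioi 0))
      rw [Set.sdiff_singleton_eq_self (by simp)] at hs
      refine hs.congr' (.of_forall fun t => ?_)
      simp [slope_def_field]
  refine key.congr' ?_
  filter_upwards [hmem] with t ht
  rw [integral_div, integral_sub (integrable_const _) (h.integrable_exp_mul ht.1.le ht.2.le), mgf]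
  simp

/-- For small `t` the slope exceeds `J`, so the moment is below `1 - t J ≤ exp (-t J)`. This makes
the walk outrun every speed `J` below its drift with geometric tails. -/
theorem exists_mgf_le_exp (h : IsLLRIncrement P L) {J : ℝ} (hJ : J < ∫ x, L x ∂P) :
    ∃ t : ℝ, 0 < t ∧ t < 1 ∧ mgf L P (-t) ≤ Real.exp (-t * J) := by
  have hmem : ∀ᶠ t : ℝ in 𝓝[>] 0, t ∈ Set.Ioo (0 : ℝ) 1 := Ioo_mem_nhdsGT one_pos
  obtain ⟨t, ht, hlt⟩ := (hmem.and (h.tendsto_mgf_slope.eventually (lt_mem_nhds hJ))).exists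
  refine ⟨t, ht.1, ht.2, ?_⟩
  rw [lt_div_iff₀ ht.1] at hlt
  linarith [Real.add_one_le_exp (-t * J)]

end IsLLRIncrement

/-! ### Random walks under the product law -/

/-- The sum of the first `k` increments of coordinate `i`. -/
noncomputable def walk {ι : Type*} (L : ℝ → ℝ) (i : ι) (k : ℕ) (x : ℕ × ι → ℝ) : ℝ :=
  ∑ j ∈ Finset.range k, L (x (j, i))

theorem measurable_walk {ι : Type*} {L : ℝ → ℝ} (hL : Measurable L) (i : ι) (k : ℕ) :
    Measurable (walk L i k) :=
  Finset.measurable_sum _ fun j _ => hL.comp (measurable_pi_apply (j, i))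

section Product

variable {ι : Type*} {P : Measure ℝ} [IsProbabilityMeasure P] {L : ℝ → ℝ}

theorem mgf_walk (hL : Measurable L) (i : ι) (k : ℕ) (t : ℝ) :
    mgf (walk L i k) (Measure.infinitePi fun _ : ℕ × ι => P) t = mgf L P t ^ k := by
  have hind : iIndepFun (fun j (x : ℕ × ι → ℝ) => L (x (j, i)))
      (Measure.infinitePi fun _ : ℕ × ι => P) :=
    (iIndepFun_infinitePi (X := fun _ : ℕ × ι => L) fun _ => hL).precomp
      (g := fun j : ℕ => (j, i)) fun a b hab => by simpa using hab
  have hw : walk L i k = ∑ j ∈ Finset.range k, fun x : ℕ × ι → ℝ => L (x (j, i)) := by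
    ext x
    simp [walk]
  rw [hw, hind.mgf_sum fun j => hL.comp (measurable_pi_apply _)]
  have hm : ∀ j : ℕ, mgf (fun x : ℕ × ι → ℝ => L (x (j, i)))
      (Measure.infinitePi fun _ : ℕ × ι => P) t = mgf L P t := fun j => by
    have hp := measurePreserving_eval_infinitePi (fun _ : ℕ × ι => P) (j, i)
    have := mgf_map (μ := Measure.infinitePi fun _ : ℕ × ι => P) (X := L) (t := t)
      (Y := Function.eval (j, i)) hp.measurable.aemeasurable
      (Real.measurable_exp.comp (hL.const_mul t)).aestronglyMeasurable
    rw [hp.map_eq] at this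
    exact this.symm
  simp [hm]

theorem IsLLRIncrement.measure_walk_le (h : IsLLRIncrement P L) (i : ι) (k : ℕ) (y : ℝ) {t : ℝ}
    (ht0 : 0 ≤ t) (ht1 : t ≤ 1) :
    (Measure.infinitePi fun _ : ℕ × ι => P) {x | walk L i k x ≤ y} ≤
      ENNReal.ofReal (Real.exp (t * y)) * ENNReal.ofReal (mgf L P (-t)) ^ k := by
  have hint : Integrable (fun x => Real.exp (-t * walk L i k x))
      (Measure.infinitePi fun _ : ℕ × ι => P) := by
    rcases k.eq_zero_or_pos with rfl | hk
    · simp [walk]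
    -- A non-integrable exponential would have `mgf` equal to `0`, so positivity of the power yields
    -- integrability.
    refine mgf_pos_iff.1 ?_
    rw [mgf_walk h.measurable]
    exact pow_pos (mgf_pos (h.integrable_exp_mul ht0 ht1)) k
  have := measure_le_le_exp_mul_mgf (X := walk L i k) y (neg_nonpos.2 ht0) hint
  rw [mgf_walk h.measurable, neg_neg] at this
  rw [← ENNReal.ofReal_pow mgf_nonneg, ← ENNReal.ofReal_mul (Real.exp_pos _).le]
  refine le_trans ?_ (ENNReal.ofReal_le_ofReal this)
  simp

theorem tsum_ofReal_pow {r : ℝ} (h0 : 0 ≤ r) (h1 : r < 1) :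
    ∑' k : ℕ, ENNReal.ofReal r ^ k = ENNReal.ofReal (1 / (1 - r)) := by
  rw [ENNReal.tsum_geometric, one_div, ENNReal.ofReal_inv_of_pos (by linarith),
    ENNReal.ofReal_sub _ h0, ENNReal.ofReal_one]

/-- The event that coordinate `i` ever reaches the level `y`. -/
def dips (L : ℝ → ℝ) (i : ι) (y : ℝ) : Set (ℕ × ι → ℝ) := {x | ∃ k, walk L i k x ≤ y}

/-- A union bound over all times replaces a maximal inequality: Chernoff bounds sum to a geometric
series. It requires `t < 1`, which is harmless because `t` later tends to `1`. -/
theorem IsLLRIncrement.measure_dips_le (h : IsLLRIncrement P L) (i : ι) (y : ℝ) {t : ℝ}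
    (ht0 : 0 < t) (ht1 : t < 1) :
    (Measure.infinitePi fun _ : ℕ × ι => P) (dips L i y) ≤
      ENNReal.ofReal (Real.exp (t * y) / (1 - mgf L P (-t))) := by
  have hset : dips L i y = ⋃ k, {x | walk L i k x ≤ y} := by
    ext x
    simp [dips]
  rw [hset]
  refine (measure_iUnion_le _).trans ((ENNReal.tsum_le_tsum fun k =>
    h.measure_walk_le i k y ht0.le ht1.le).trans ?_)
  rw [ENNReal.tsum_mul_left, tsum_ofReal_pow mgf_nonneg (h.mgf_lt_one ht0 ht1),
    ← ENNReal.ofReal_mul (Real.exp_pos _).le, mul_one_div]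

/-- Swapping the index pair and currying turns the product over `ℕ × ι` into a product of column
laws. -/
theorem iIndepFun_columns :
    iIndepFun (fun (i : ι) (x : ℕ × ι → ℝ) (k : ℕ) => x (k, i))
      (Measure.infinitePi fun _ : ℕ × ι => P) := by
  rw [iIndepFun_iff_map_fun_eq_infinitePi_map (by fun_prop)]
  have hcol : ∀ i : ι, (Measure.infinitePi fun _ : ℕ × ι => P).map (fun x k => x (k, i)) =
      Measure.infinitePi fun _ : ℕ => P := fun i =>
    Measure.map_infinitePi_infinitePi_of_inj (P := fun _ : ℕ × ι => P)
      (f := fun k : ℕ => (k, i)) fun a b hab => by simpa using hab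
  have hswap : (Measure.infinitePi fun _ : ℕ × ι => P).map (fun x (p : ι × ℕ) => x p.swap) =
      Measure.infinitePi fun _ : ι × ℕ => P :=
    Measure.map_infinitePi_infinitePi_of_inj (P := fun _ : ℕ × ι => P) Prod.swap_injective
  simp only [hcol]
  rw [← Measure.infinitePi_map_curry (fun (_ : ι) (_ : ℕ) => P), ← hswap,
    Measure.map_map (by fun_prop) (by fun_prop)]
  rfl

theorem measure_iInter_dips (hL : Measurable L) (A : Finset ι) (y : ℝ) :
    (Measure.infinitePi fun _ : ℕ × ι => P) (⋂ i ∈ A, dips L i y) =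
      ∏ i ∈ A, (Measure.infinitePi fun _ : ℕ × ι => P) (dips L i y) := by
  let B : Set (ℕ → ℝ) := {u | ∃ k, ∑ j ∈ Finset.range k, L (u j) ≤ y}
  have hB : MeasurableSet B := by
    have : B = ⋃ k, {u | ∑ j ∈ Finset.range k, L (u j) ≤ y} := by
      ext u
      simp [B]
    rw [this]
    exact MeasurableSet.iUnion fun k => measurableSet_le
      (Finset.measurable_sum _ fun j _ => hL.comp (measurable_pi_apply j)) measurable_const
  exact (iIndepFun_columns (ι := ι) (P := P)).measure_inter_preimage_eq_mul A (fun _ _ => hB)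

theorem measurableSet_dips (hL : Measurable L) (i : ι) (y : ℝ) : MeasurableSet (dips L i y) := by
  have : dips L i y = ⋃ k, {x | walk L i k x ≤ y} := by
    ext x
    simp [dips]
  rw [this]
  exact MeasurableSet.iUnion fun k => measurableSet_le (measurable_walk hL i k) measurable_const

end Product

/-! ### Honest sensors and pathwise properties of the voting rule -/

theorem Attack.manip_of_notMem {s c : ℕ} {Ξ : Type*} [MeasurableSpace Ξ] (g : Attack s c Ξ)
    {θ : Fin 2} {i : Fin s} (hi : i ∉ g.comp θ) (z : Ξ × (ℕ × Fin s → ℝ)) (k : ℕ) :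
    g.manip θ z k i = z.2 (k, i) := by
  rw [Attack.manip, Attack.bias, g.honest θ k _ i hi, add_zero]

theorem Attack.cumLLR_manip {s c : ℕ} {Ξ : Type*} [MeasurableSpace Ξ] (g : Attack s c Ξ)
    (μ ν : Measure ℝ) {θ : Fin 2} {i : Fin s} (hi : i ∉ g.comp θ) (z : Ξ × (ℕ × Fin s → ℝ))
    (n : ℕ) : cumLLR μ ν (g.manip θ z) i n = walk (llr μ ν) i n z.2 := by
  simp only [cumLLR, walk, g.manip_of_notMem hi]

theorem exists_of_firstTime_ne_top {p : ℕ → Prop} (h : firstTime p ≠ ⊤) : ∃ k, 1 ≤ k ∧ p k := by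
  by_contra! hc
  refine h (iInf₂_eq_top.2 fun k hk => absurd hk.2 (hc k hk.1))

theorem firstTime_le {p : ℕ → Prop} {k : ℕ} (hk : 1 ≤ k) (hp : p k) : firstTime p ≤ k :=
  (firstTime_le_iff p k).2 ⟨k, hk, le_rfl, hp⟩

theorem one_le_firstTime (p : ℕ → Prop) : 1 ≤ firstTime p :=
  le_iInf₂ fun k hk => by exact_mod_cast hk.1

theorem Detector.decisionProb_le_one {s : ℕ} (f : Detector s) (h : Fin 2) (x : ℕ → Fin s → ℝ) :
    f.decisionProb h x ≤ 1 := by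
  rw [Detector.decisionProb]
  split
  · exact zero_le_one
  · split
    · exact zero_le_one
    · rename_i p _
      rw [ENNReal.ofReal_le_one]
      split_ifs
      · linarith [p.2.1]
      · exact p.2.2

section VotingRule

variable (μ ν : Measure ℝ) {s r : ℕ} {a b : ℝ} {x : ℕ → Fin s → ℝ}

theorem stopTime_votingRule_le_of_le {k : ℕ} (hk : 1 ≤ k)
    (h : min (orderStat (tauMinus μ ν a x) r) (orderStat (tauPlus μ ν b x) r) ≤ k) :
    (votingRule μ ν s r a b).stopTime x ≤ k := by
  refine firstTime_le hk ?_
  simp only [votingRule, voteDecision, if_neg (not_lt.2 h)]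
  split_ifs <;> simp

/-- A stop with `τ⁺_(r) = ⊤` has `τ⁻_(r)` finite, hence decides 0. A tie at a finite time already
lies in the event, where the coin is bounded by `1`. -/
theorem decisionProb_one_le :
    (votingRule μ ν s r a b).decisionProb 1 x ≤
      {x | orderStat (tauPlus μ ν b x) r ≠ ⊤}.indicator 1 x := by
  by_cases hp : orderStat (tauPlus μ ν b x) r = ⊤
  · simp only [Detector.decisionProb, votingRule, voteDecision, hp]
    split_ifs <;> simp_all
  · rw [Set.indicator_of_mem (by exact hp)]
    exact Detector.decisionProb_le_one _ _ x

theorem decisionProb_zero_le :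
    (votingRule μ ν s r a b).decisionProb 0 x ≤
      {x | orderStat (tauMinus μ ν a x) r ≠ ⊤}.indicator 1 x := by
  by_cases hp : orderStat (tauMinus μ ν a x) r = ⊤
  · simp only [Detector.decisionProb, votingRule, voteDecision, hp]
    split_ifs <;> simp_all
  · rw [Set.indicator_of_mem (by exact hp)]
    exact Detector.decisionProb_le_one _ _ x

end VotingRule

/-- Pathwise tail-sum formula: beyond `n`, `T` is counted by the times it has not yet reached. It
includes `T = ⊤`, so no finiteness has to be known beforehand. -/
theorem ENat.toENNReal_le_add_tsum {T : ℕ∞} {n : ℕ} {f : ℕ → ℝ≥0∞}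
    (h : ∀ k : ℕ, ((n + k : ℕ) : ℕ∞) < T → 1 ≤ f k) : (T : ℝ≥0∞) ≤ n + ∑' k, f k := by
  have hnat : ∀ m : ℕ, (m : ℕ∞) ≤ T → (m : ℝ≥0∞) ≤ n + ∑' k, f k := fun m hm => by
    rcases le_total m n with hmn | hmn
    · exact le_add_right (by exact_mod_cast hmn)
    · obtain ⟨d, rfl⟩ := Nat.exists_eq_add_of_le hmn
      rw [Nat.cast_add]
      gcongr
      refine le_trans ?_ (ENNReal.sum_le_tsum (Finset.range d))
      have := Finset.sum_le_sum (s := Finset.range d) (f := fun _ => (1 : ℝ≥0∞)) (g := f)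
        fun k hk => h k (lt_of_lt_of_le (by
          exact_mod_cast Nat.add_lt_add_left (Finset.mem_range.1 hk) n) hm)
      simpa using this
  induction T using ENat.recTopCoe with
  | coe m => simpa using hnat m le_rfl
  | top =>
    refine le_of_eq (ENNReal.eq_top_of_forall_nnreal_le fun q => ?_).symm
    obtain ⟨m, hm⟩ := exists_nat_ge q
    exact le_trans (by exact_mod_cast hm) (hnat m le_top)

/-! ### Error and delay bounds under an arbitrary attack -/

section Attacked

variable {Ξ : Type*} [MeasurableSpace Ξ] {μ ν : Measure ℝ} {s c : ℕ}
  {ρ : Measure Ξ} [IsProbabilityMeasure ρ] {g : Attack s c Ξ} {θ : Fin 2} {L : ℝ → ℝ}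

/-- Among `s - c` votes at most `c` are forged, so some set of `s - 2c` honest sensors dips. That
event concerns true observations only, so the private randomness integrates out; a union over at
most `2 ^ s` sets and independence finish. -/
theorem attackedLaw_orderStat_ne_top_le [IsProbabilityMeasure (obsLaw μ ν θ)]
    (h : IsLLRIncrement (obsLaw μ ν θ) L) {τ : (ℕ → Fin s → ℝ) → Fin s → ℕ∞}
    (hτm : ∀ i, Measurable fun x => τ x i) {y : ℝ}
    (hτ : ∀ i ∉ g.comp θ, ∀ z, τ (g.manip θ z) i ≠ ⊤ → z.2 ∈ dips L i (-y))
    {t : ℝ} (ht0 : 0 < t) (ht1 : t < 1) :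
    attackedLaw μ ν ρ g θ {x | orderStat (τ x) (s - c) ≠ ⊤} ≤
      ENNReal.ofReal (2 ^ s *
        (Real.exp (t * -y) / (1 - mgf L (obsLaw μ ν θ) (-t))) ^ (s - 2 * c)) := by
  classical
  set r : ℝ := Real.exp (t * -y) / (1 - mgf L (obsLaw μ ν θ) (-t)) with hr
  have hr0 : 0 ≤ r := div_nonneg (Real.exp_pos _).le (by linarith [h.mgf_lt_one ht0 ht1])
  let F : Set (ℕ × Fin s → ℝ) :=
    ⋃ A ∈ Finset.univ.powersetCard (s - 2 * c), ⋂ i ∈ A, dips L i (-y)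
  have hF : MeasurableSet F :=
    Finset.measurableSet_biUnion _ fun A _ => Finset.measurableSet_biInter _ fun i _ =>
      measurableSet_dips h.measurable i _
  have hE : MeasurableSet {x | orderStat (τ x) (s - c) ≠ ⊤} :=
    (measurable_orderStat hτm (s - c)) (MeasurableSet.singleton ⊤).compl
  have hsub : g.manip θ ⁻¹' {x | orderStat (τ x) (s - c) ≠ ⊤} ⊆ Prod.snd ⁻¹' F := by
    intro z hz
    obtain ⟨n, hn⟩ := ENat.ne_top_iff_exists.1 hz
    have hcard := (orderStat_le_iff (τ (g.manip θ z)) (s - c) n).1 hn.ge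
    set V := Finset.univ.filter fun i => τ (g.manip θ z) i ≤ n with hV
    have hcard' : s - 2 * c ≤ (V \ g.comp θ).card := by
      have := Finset.le_card_sdiff (g.comp θ) V
      rw [g.card_comp θ] at this
      omega
    obtain ⟨A, hA, hAc⟩ := Finset.exists_subset_card_eq hcard'
    refine Set.mem_biUnion (x := A) ?_ (Set.mem_iInter₂.2 fun i hi => ?_)
    · exact Finset.mem_powersetCard.2 ⟨Finset.subset_univ A, hAc⟩
    · have hi' := Finset.mem_sdiff.1 (hA hi)
      refine hτ i hi'.2 z (ne_top_of_le_ne_top (ENat.natCast_ne_top n) ?_)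
      exact (Finset.mem_filter.1 hi'.1).2
  have : IsProbabilityMeasure (trueLaw μ ν s θ) := by unfold trueLaw; infer_instance
  calc attackedLaw μ ν ρ g θ {x | orderStat (τ x) (s - c) ≠ ⊤}
      = (ρ.prod (trueLaw μ ν s θ)) (g.manip θ ⁻¹' {x | orderStat (τ x) (s - c) ≠ ⊤}) :=
        Measure.map_apply (g.measurable_manip θ) hE
    _ ≤ (ρ.prod (trueLaw μ ν s θ)) (Prod.snd ⁻¹' F) := measure_mono hsub
    _ = trueLaw μ ν s θ F := measurePreserving_snd.measure_preimage hF.nullMeasurableSet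
    _ ≤ ∑ A ∈ Finset.univ.powersetCard (s - 2 * c),
          trueLaw μ ν s θ (⋂ i ∈ A, dips L i (-y)) := measure_biUnion_finset_le _ _
    _ ≤ ∑ A ∈ (Finset.univ : Finset (Fin s)).powersetCard (s - 2 * c),
          ENNReal.ofReal r ^ (s - 2 * c) := by
        refine Finset.sum_le_sum fun A hA => ?_
        rw [trueLaw, measure_iInter_dips h.measurable, ← (Finset.mem_powersetCard.1 hA).2]
        exact Finset.prod_le_pow_card _ _ _ fun i _ => h.measure_dips_le i (-y) ht0 ht1
    _ ≤ 2 ^ s * ENNReal.ofReal r ^ (s - 2 * c) := by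
        rw [Finset.sum_const, nsmul_eq_mul, Finset.card_powersetCard, Finset.card_univ,
          Fintype.card_fin]
        gcongr
        exact_mod_cast Nat.choose_le_two_pow s (s - 2 * c)
    _ = ENNReal.ofReal (2 ^ s * r ^ (s - 2 * c)) := by
        rw [ENNReal.ofReal_mul (by positivity), ENNReal.ofReal_pow hr0,
          ENNReal.ofReal_pow (by norm_num)]
        simp

/-- The rule can be still running at time `k ≥ 1` only if some honest walk is below `y` at that very
time. The Chernoff bounds for these events sum to a constant once `k` passes `y / J`. -/
theorem lintegral_stopTime_le [IsProbabilityMeasure (obsLaw μ ν θ)]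
    (h : IsLLRIncrement (obsLaw μ ν θ) L) {T : (ℕ → Fin s → ℝ) → ℕ∞} {y : ℝ} (hy : 0 < y)
    (hT : ∀ z, ∀ k : ℕ, 1 ≤ k → (∀ i ∉ g.comp θ, y ≤ walk L i k z.2) → T (g.manip θ z) ≤ k)
    {t J : ℝ} (hJ : 0 < J) (ht0 : 0 < t) (ht1 : t < 1)
    (htJ : mgf L (obsLaw μ ν θ) (-t) ≤ Real.exp (-t * J)) :
    ∫⁻ x, (T x : ℝ≥0∞) ∂(attackedLaw μ ν ρ g θ) ≤
      ENNReal.ofReal (y / J + (2 + s * (1 / (1 - mgf L (obsLaw μ ν θ) (-t))))) := by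
  classical
  set q : ℝ := mgf L (obsLaw μ ν θ) (-t) with hq
  have hq0 : 0 ≤ q := mgf_nonneg
  have hq1 : q < 1 := h.mgf_lt_one ht0 ht1
  -- At time `n ≥ y / J` the factor `exp (t * y)` is already absorbed by `q ^ n`. The extra `1`
  -- secures `1 ≤ n + k`.
  set n : ℕ := ⌈y / J⌉₊ + 1 with hn
  have hny : y / J ≤ n := (Nat.le_ceil _).trans (by exact_mod_cast Nat.le_succ _)
  have hn2 : (n : ℝ) ≤ y / J + 2 := by
    have := (Nat.ceil_lt_add_one (div_pos hy hJ).le).le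
    push_cast [hn]
    linarith
  have hdecay : Real.exp (t * y) * q ^ n ≤ 1 := by
    calc Real.exp (t * y) * q ^ n ≤ Real.exp (t * y) * Real.exp (-t * J) ^ n := by gcongr
      _ = Real.exp (t * (y - n * J)) := by rw [← Real.exp_nat_mul, ← Real.exp_add]; ring_nf
      _ ≤ 1 := Real.exp_le_one_iff.2 (mul_nonpos_of_nonneg_of_nonpos ht0.le
          (sub_nonpos.2 ((div_le_iff₀ hJ).1 hny)))
  -- Compromised sensors may be included: their true observations have the same law, and the sum
  -- then does not depend on the attack.
  let f : ℕ → (ℕ × Fin s → ℝ) → ℝ≥0∞ := fun k x =>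
    ∑ i : Fin s, {x | walk L i (n + k) x ≤ y}.indicator 1 x
  have hset : ∀ (k : ℕ) (i : Fin s), MeasurableSet {x | walk L i (n + k) x ≤ y} := fun k i =>
    measurableSet_le (measurable_walk h.measurable i _) measurable_const
  have hfm : ∀ k, Measurable (f k) := fun k =>
    Finset.measurable_sum _ fun i _ => measurable_one.indicator (hset k i)
  have hbound : ∀ z, (T (g.manip θ z) : ℝ≥0∞) ≤ n + ∑' k, f k z.2 := fun z => by
    refine ENat.toENNReal_le_add_tsum fun k hk => ?_
    by_contra hlt
    refine absurd (hT z (n + k) (by omega) fun i _ => ?_) (not_le.2 hk)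
    by_contra hw
    refine hlt (le_trans ?_ (Finset.single_le_sum (fun _ _ => zero_le) (Finset.mem_univ i)))
    rw [Set.indicator_of_mem (by exact (not_le.1 hw).le)]
    rfl
  have : IsProbabilityMeasure (trueLaw μ ν s θ) := by unfold trueLaw; infer_instance
  have hint : ∀ k, ∫⁻ x, f k x ∂(trueLaw μ ν s θ) ≤ s * ENNReal.ofReal q ^ k := fun k => by
    rw [lintegral_finsetSum _ fun i _ => measurable_one.indicator (hset k i)]
    calc ∑ i : Fin s, ∫⁻ x, {x | walk L i (n + k) x ≤ y}.indicator 1 x ∂(trueLaw μ ν s θ)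
        ≤ ∑ _i : Fin s, ENNReal.ofReal q ^ k := by
          refine Finset.sum_le_sum fun i _ => ?_
          rw [lintegral_indicator_one (hset k i)]
          refine (h.measure_walk_le i (n + k) y ht0.le ht1.le).trans ?_
          rw [pow_add, ← mul_assoc, ← hq, ← ENNReal.ofReal_pow hq0 n,
            ← ENNReal.ofReal_mul (Real.exp_pos _).le]
          exact mul_le_of_le_one_left zero_le (ENNReal.ofReal_le_one.2 hdecay)
      _ = s * ENNReal.ofReal q ^ k := by simp
  calc ∫⁻ x, (T x : ℝ≥0∞) ∂(attackedLaw μ ν ρ g θ)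
      -- This inequality holds for every `T`, so no measurability of the stopping time is needed.
      ≤ ∫⁻ z, (T (g.manip θ z) : ℝ≥0∞) ∂(ρ.prod (trueLaw μ ν s θ)) := lintegral_map_le _ _
    _ ≤ ∫⁻ z, (n + ∑' k, f k z.2) ∂(ρ.prod (trueLaw μ ν s θ)) := lintegral_mono hbound
    _ = ∫⁻ x, (n + ∑' k, f k x) ∂(trueLaw μ ν s θ) :=
        measurePreserving_snd.lintegral_comp
          (f := fun x => n + ∑' k, f k x) (measurable_const.add (Measurable.tsum hfm))
    _ = n + ∑' k, ∫⁻ x, f k x ∂(trueLaw μ ν s θ) := by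
        rw [lintegral_add_left measurable_const, lintegral_const, measure_univ, mul_one,
          lintegral_tsum fun k => (hfm k).aemeasurable]
    _ ≤ n + ∑' k, s * ENNReal.ofReal q ^ k := by gcongr with k; exact hint k
    _ = ENNReal.ofReal (n + s * (1 / (1 - q))) := by
        have h1 : 0 ≤ 1 / (1 - q) := by
          have := sub_pos.2 hq1
          positivity
        rw [ENNReal.tsum_mul_left, tsum_ofReal_pow hq0 hq1, ENNReal.ofReal_add (by positivity)
          (by positivity), ENNReal.ofReal_mul (by positivity)]
        simp
    _ ≤ ENNReal.ofReal (y / J + (2 + s * (1 / (1 - q)))) := by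
        apply ENNReal.ofReal_le_ofReal
        linarith

omit [IsProbabilityMeasure ρ] in
theorem one_le_delay [IsProbabilityMeasure (attackedLaw μ ν ρ g 0)] (f : Detector s) :
    1 ≤ delay μ ν ρ g f := by
  refine le_trans ?_ (le_iSup _ (0 : Fin 2))
  calc (1 : ℝ≥0∞) = ∫⁻ _, 1 ∂(attackedLaw μ ν ρ g 0) := by simp
    _ ≤ _ := lintegral_mono fun x => by
      have : ((1 : ℕ∞) : ℝ≥0∞) ≤ (f.stopTime x : ℝ≥0∞) :=
        ENat.toENNReal_le.2 (one_le_firstTime _)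
      simpa using this

end Attacked

/-! ### Log-likelihood increments and the logarithmic ratio -/

section

variable {μ ν : Measure ℝ} [IsProbabilityMeasure μ] [IsProbabilityMeasure ν]

theorem isLLRIncrement_llr (hμν : μ ≪ ν) (hνμ : ν ≪ μ) (hint1 : Integrable (llr μ ν) μ)
    (hI1 : 0 < klOne μ ν) : IsLLRIncrement μ (llr μ ν) where
  measurable := measurable_llr μ ν
  integrable := hint1
  integral_pos := hI1
  integrable_exp_neg :=
    (integrable_congr (exp_neg_llr hμν)).2 Measure.integrable_toReal_rnDeriv
  integral_exp_neg := by
    rw [integral_congr_ae (exp_neg_llr hμν), Measure.integral_toReal_rnDeriv hνμ]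
    simp

theorem isLLRIncrement_neg_llr (hμν : μ ≪ ν) (hνμ : ν ≪ μ) (hint0 : Integrable (llr μ ν) ν)
    (hI0 : 0 < klZero μ ν) : IsLLRIncrement ν (-llr μ ν) where
  measurable := (measurable_llr μ ν).neg
  integrable := hint0.neg
  integral_pos := by
    simp only [Pi.neg_apply, integral_neg]
    exact hI0
  integrable_exp_neg := by
    simp only [Pi.neg_apply, neg_neg]
    exact (integrable_congr (exp_llr_of_ac' μ ν hνμ)).2 Measure.integrable_toReal_rnDeriv
  integral_exp_neg := by
    simp only [Pi.neg_apply, neg_neg]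
    rw [integral_congr_ae (exp_llr_of_ac' μ ν hνμ), Measure.integral_toReal_rnDeriv hμν]
    simp

end

theorem walk_neg {ι : Type*} (L : ℝ → ℝ) (i : ι) (k : ℕ) (x : ℕ × ι → ℝ) :
    walk (-L) i k x = -walk L i k x := by
  simp [walk]

/-- Eliminating `M` from both bounds gives `κ J D ≤ log (1/p) + log C + κ J D₀`; for small `p` the
constants are absorbed by the gap `κ J - q`. The `ε` is uniform in `M`, as required by a limit along
`α → 0` rather than along the thresholds. -/
theorem exists_le_logRatio {C κ J D₀ q : ℝ} (hC : 0 < C) (hκ : 0 < κ) (hJ : 0 < J) (hq0 : 0 ≤ q)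
    (hq : q < κ * J) :
    ∃ ε : ℝ≥0∞, 0 < ε ∧ ∀ (p D : ℝ≥0∞) (M : ℝ), p ≤ ε → 1 ≤ D →
      p ≤ ENNReal.ofReal (C * Real.exp (-κ * M)) → D ≤ ENNReal.ofReal (M / J + D₀) →
      (q : EReal) ≤ logRatio p D := by
  have hκJ : 0 < κ * J := mul_pos hκ hJ
  have hgap : 0 < κ * J - q := sub_pos.2 hq
  -- `K` is the value of `log (1/p)` from which the gap `κ * J - q` pays for the constants.
  set K : ℝ := q * (Real.log C + κ * J * D₀) / (κ * J - q) with hK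
  refine ⟨ENNReal.ofReal (Real.exp (-K)), by simp [Real.exp_pos], fun p D M hp hD hpM hDM => ?_⟩
  have hDtop : D ≠ ⊤ := ne_top_of_le_ne_top ENNReal.ofReal_ne_top hDM
  have hptop : p ≠ ⊤ := ne_top_of_le_ne_top ENNReal.ofReal_ne_top hp
  have hMpos : 0 ≤ M / J + D₀ := by
    by_contra hneg
    rw [ENNReal.ofReal_of_nonpos (not_le.1 hneg).le] at hDM
    exact absurd (hD.trans hDM) (by simp)
  have hd := ENNReal.toReal_le_of_le_ofReal hMpos hDM
  rw [logRatio, EReal.le_div_iff_mul_le (by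
    rw [gt_iff_lt, ← EReal.coe_ennreal_zero, EReal.coe_ennreal_lt_coe_ennreal_iff]
    exact lt_of_lt_of_le one_pos hD) (by simpa using hDtop), ENNReal.log_inv]
  rcases eq_or_ne p 0 with rfl | hp0
  · simp
  rw [ENNReal.log_pos_real hp0 hptop, ← EReal.coe_ennreal_toReal hDtop, ← EReal.coe_mul,
    ← EReal.coe_neg, EReal.coe_le_coe_iff]
  have hpr : 0 < p.toReal := ENNReal.toReal_pos hp0 hptop
  have h1 := ENNReal.toReal_le_of_le_ofReal (Real.exp_pos _).le hp
  have h2 := ENNReal.toReal_le_of_le_ofReal (mul_pos hC (Real.exp_pos _)).le hpM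
  have h3 := Real.log_le_log hpr h1
  have h4 := Real.log_le_log hpr h2
  rw [Real.log_exp] at h3
  rw [Real.log_mul hC.ne' (Real.exp_ne_zero _), Real.log_exp] at h4
  have h5 : q * (Real.log C + κ * J * D₀) ≤ -Real.log p.toReal * (κ * J - q) := by
    rw [← div_le_iff₀ hgap, ← hK]
    linarith
  have h6 : D.toReal * (κ * J) ≤ κ * M + κ * J * D₀ := by
    calc D.toReal * (κ * J) ≤ (M / J + D₀) * (κ * J) := by gcongr
      _ = κ * M + κ * J * D₀ := by field_simp
  have h7 := mul_le_mul_of_nonneg_left h6 hq0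
  have h8 := mul_le_mul_of_nonneg_left h4 hq0
  refine le_of_mul_le_mul_right (a := κ * J) ?_ hκJ
  linarith

/-! ### Bounds for the voting rule with `r = s - c` -/

section VotingRule

variable {Ξ : Type*} [MeasurableSpace Ξ] {μ ν : Measure ℝ} [IsProbabilityMeasure μ]
  [IsProbabilityMeasure ν] {s c : ℕ} {ρ : Measure Ξ} [IsProbabilityMeasure ρ]
  {g : Attack s c Ξ} {t J a b : ℝ}

instance obsLaw.instIsProbabilityMeasure (θ : Fin 2) : IsProbabilityMeasure (obsLaw μ ν θ) := by
  unfold obsLaw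
  split <;> infer_instance

instance attackedLaw.instIsProbabilityMeasure (θ : Fin 2) :
    IsProbabilityMeasure (attackedLaw μ ν ρ g θ) := by
  have : IsProbabilityMeasure (trueLaw μ ν s θ) := by unfold trueLaw; infer_instance
  exact Measure.isProbabilityMeasure_map (g.measurable_manip θ).aemeasurable

theorem typeI_votingRule_le (h : IsLLRIncrement ν (-llr μ ν)) (ht0 : 0 < t) (ht1 : t < 1) :
    typeI μ ν ρ g (votingRule μ ν s (s - c) a b) ≤ ENNReal.ofReal (2 ^ s *
      (Real.exp (t * -b) / (1 - mgf (-llr μ ν) ν (-t))) ^ (s - 2 * c)) := by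
  refine (lintegral_mono fun x => decisionProb_one_le μ ν).trans
    ((lintegral_indicator_one_le _).trans ?_)
  refine attackedLaw_orderStat_ne_top_le (θ := 0) h (fun i => measurable_firstTime fun n =>
    measurableSet_le measurable_const (measurable_cumLLR μ ν i n)) (fun i hi z hz => ?_) ht0 ht1
  obtain ⟨k, -, hk⟩ := exists_of_firstTime_ne_top hz
  refine ⟨k, ?_⟩
  rw [g.cumLLR_manip μ ν hi] at hk
  rw [walk_neg]
  exact neg_le_neg hk

theorem typeII_votingRule_le (h : IsLLRIncrement μ (llr μ ν)) (ht0 : 0 < t) (ht1 : t < 1) :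
    typeII μ ν ρ g (votingRule μ ν s (s - c) a b) ≤ ENNReal.ofReal (2 ^ s *
      (Real.exp (t * -a) / (1 - mgf (llr μ ν) μ (-t))) ^ (s - 2 * c)) := by
  refine (lintegral_mono fun x => decisionProb_zero_le μ ν).trans
    ((lintegral_indicator_one_le _).trans ?_)
  refine attackedLaw_orderStat_ne_top_le (θ := 1) h (fun i => measurable_firstTime fun n =>
    measurableSet_le (measurable_cumLLR μ ν i n) measurable_const) (fun i hi z hz => ?_) ht0 ht1
  obtain ⟨k, -, hk⟩ := exists_of_firstTime_ne_top hz
  refine ⟨k, ?_⟩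
  rwa [g.cumLLR_manip μ ν hi] at hk

omit [IsProbabilityMeasure μ] [IsProbabilityMeasure ν] in
theorem Attack.orderStat_le_of_honest {θ : Fin 2} {τ : Fin s → ℕ∞} {k : ℕ} (g : Attack s c Ξ)
    (hτ : ∀ i ∉ g.comp θ, τ i ≤ k) : orderStat τ (s - c) ≤ k := by
  rw [orderStat_le_iff]
  have hcard : (g.comp θ)ᶜ.card = s - c := by
    rw [Finset.card_compl, Fintype.card_fin, g.card_comp θ]
  rw [← hcard]
  exact Finset.card_le_card fun i hi => by simpa using hτ i (by simpa using hi)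

theorem lintegral_stopTime_zero_le (h : IsLLRIncrement ν (-llr μ ν)) (ha : 0 < a) (hJ : 0 < J)
    (ht0 : 0 < t) (ht1 : t < 1) (htJ : mgf (-llr μ ν) ν (-t) ≤ Real.exp (-t * J)) :
    ∫⁻ x, ((votingRule μ ν s (s - c) a b).stopTime x : ℝ≥0∞) ∂(attackedLaw μ ν ρ g 0) ≤
      ENNReal.ofReal (a / J + (2 + s * (1 / (1 - mgf (-llr μ ν) ν (-t))))) := by
  refine lintegral_stopTime_le (θ := 0) h ha (fun z k hk hz => ?_) hJ ht0 ht1 htJ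
  refine stopTime_votingRule_le_of_le μ ν hk (min_le_of_left_le ?_)
  refine g.orderStat_le_of_honest (θ := 0) fun i hi => firstTime_le hk ?_
  rw [g.cumLLR_manip μ ν hi]
  have := hz i hi
  rw [walk_neg] at this
  linarith

theorem lintegral_stopTime_one_le (h : IsLLRIncrement μ (llr μ ν)) (hb : 0 < b) (hJ : 0 < J)
    (ht0 : 0 < t) (ht1 : t < 1) (htJ : mgf (llr μ ν) μ (-t) ≤ Real.exp (-t * J)) :
    ∫⁻ x, ((votingRule μ ν s (s - c) a b).stopTime x : ℝ≥0∞) ∂(attackedLaw μ ν ρ g 1) ≤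
      ENNReal.ofReal (b / J + (2 + s * (1 / (1 - mgf (llr μ ν) μ (-t))))) := by
  refine lintegral_stopTime_le (θ := 1) h hb (fun z k hk hz => ?_) hJ ht0 ht1 htJ
  refine stopTime_votingRule_le_of_le μ ν hk (min_le_of_right_le ?_)
  refine g.orderStat_le_of_honest (θ := 1) fun i hi => firstTime_le hk ?_
  rw [g.cumLLR_manip μ ν hi]
  exact hz i hi

/-- State 0 stops through `a` and state 1 through `b`, hence the maximum. The Chernoff parameters
chosen for `J` enter only `D₀`. -/
theorem exists_delay_le (h1 : IsLLRIncrement μ (llr μ ν)) (h0 : IsLLRIncrement ν (-llr μ ν))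
    (hJ : 0 < J) (hJ1 : J < klOne μ ν) (hJ0 : J < klZero μ ν) :
    ∃ D₀ : ℝ, ∀ a b : ℝ, 0 < a → 0 < b →
      delay μ ν ρ g (votingRule μ ν s (s - c) a b) ≤ ENNReal.ofReal (max a b / J + D₀) := by
  obtain ⟨t, ht0, ht1, ht⟩ := h1.exists_mgf_le_exp hJ1
  obtain ⟨u, hu0, hu1, hu⟩ := h0.exists_mgf_le_exp (J := J) (by
    simpa only [Pi.neg_apply, integral_neg, klZero] using hJ0)
  refine ⟨max (2 + s * (1 / (1 - mgf (-llr μ ν) ν (-u))))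
    (2 + s * (1 / (1 - mgf (llr μ ν) μ (-t)))), fun a b ha hb => iSup_le fun θ => ?_⟩
  fin_cases θ
  · refine (lintegral_stopTime_zero_le h0 ha hJ hu0 hu1 hu).trans (ENNReal.ofReal_le_ofReal ?_)
    exact add_le_add (by gcongr; exact le_max_left _ _) (le_max_left _ _)
  · refine (lintegral_stopTime_one_le h1 hb hJ ht0 ht1 ht).trans (ENNReal.ofReal_le_ofReal ?_)
    exact add_le_add (by gcongr; exact le_max_right _ _) (le_max_right _ _)

theorem two_pow_mul_exp_div_pow (r y : ℝ) (hsc : 2 * c < s) :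
    2 ^ s * (Real.exp (t * -y) / r) ^ (s - 2 * c) =
      2 ^ s / r ^ (s - 2 * c) * Real.exp (-(t * (s - 2 * c)) * y) := by
  rw [div_pow, ← Real.exp_nat_mul, Nat.cast_sub hsc.le]
  push_cast
  rw [show ((s : ℝ) - 2 * c) * (t * -y) = -(t * (s - 2 * c)) * y by ring]
  ring

/-- The last clause allows any `p`, so that it serves both the common value `α = β` and `max α β`.
-/
theorem exists_error_bounds (h1 : IsLLRIncrement μ (llr μ ν))
    (h0 : IsLLRIncrement ν (-llr μ ν)) (hsc : 2 * c < s) {q : ℝ} (hq0 : 0 ≤ q)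
    (hq : q < ((s : ℝ) - 2 * c) * min (klZero μ ν) (klOne μ ν)) :
    ∃ (κ C : ℝ) (ε : ℝ≥0∞), 0 < κ ∧ 0 < C ∧ 0 < ε ∧ ∀ a b : ℝ, 0 < a → 0 < b →
      typeI μ ν ρ g (votingRule μ ν s (s - c) a b) ≤ ENNReal.ofReal (C * Real.exp (-κ * b)) ∧
      typeII μ ν ρ g (votingRule μ ν s (s - c) a b) ≤ ENNReal.ofReal (C * Real.exp (-κ * a)) ∧
      ∀ p ≤ ε, p ≤ ENNReal.ofReal (C * Real.exp (-κ * max a b)) →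
        (q : EReal) ≤ logRatio p (delay μ ν ρ g (votingRule μ ν s (s - c) a b)) := by
  set I := min (klZero μ ν) (klOne μ ν) with hI
  have hN : (0 : ℝ) < (s : ℝ) - 2 * c := by
    have : (2 * c : ℝ) < s := by exact_mod_cast hsc
    linarith
  have hIpos : 0 < I := by
    by_contra hneg
    linarith [mul_nonpos_of_nonneg_of_nonpos hN.le (not_lt.1 hneg)]
  have hNI := mul_pos hN hIpos
  set w : ℝ := q / (((s : ℝ) - 2 * c) * I) with hw
  have hw0 : 0 ≤ w := div_nonneg hq0 hNI.le
  have hw1 : w < 1 := (div_lt_one hNI).2 hq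
  -- The same `t` is the Chernoff exponent of the errors and the fraction in the speed `J = t * I`,
  -- so the attained rate is `t ^ 2 * (s - 2 * c) * I`.
  set t : ℝ := (1 + w) / 2 with ht
  have ht0 : 0 < t := by linarith
  have ht1 : t < 1 := by linarith
  have htI : t * I < I := mul_lt_of_lt_one_left hIpos ht1
  have hκ : 0 < t * ((s : ℝ) - 2 * c) := mul_pos ht0 hN
  obtain ⟨D₀, hD⟩ := exists_delay_le (ρ := ρ) (g := g) h1 h0 (mul_pos ht0 hIpos)
    (htI.trans_le (min_le_right _ _)) (htI.trans_le (min_le_left _ _))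
  have hr1 := sub_pos.2 (h1.mgf_lt_one ht0 ht1)
  have hr0 := sub_pos.2 (h0.mgf_lt_one ht0 ht1)
  set C : ℝ := max (2 ^ s / (1 - mgf (-llr μ ν) ν (-t)) ^ (s - 2 * c))
    (2 ^ s / (1 - mgf (llr μ ν) μ (-t)) ^ (s - 2 * c)) with hC
  have hCpos : 0 < C := lt_max_of_lt_left (by positivity)
  have hq' : q < t * ((s : ℝ) - 2 * c) * (t * I) := by
    -- AM-GM for `1` and `w`: the midpoint squared exceeds the product when `w < 1`.
    have hwt : w < t * t := by nlinarith [sq_pos_of_pos (sub_pos.2 hw1)]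
    calc q = w * (((s : ℝ) - 2 * c) * I) := (div_mul_cancel₀ q hNI.ne').symm
      _ < t * t * (((s : ℝ) - 2 * c) * I) := by gcongr
      _ = _ := by ring
  obtain ⟨ε, hε, hlog⟩ := exists_le_logRatio (D₀ := D₀) hCpos hκ (mul_pos ht0 hIpos) hq0 hq'
  refine ⟨_, C, ε, hκ, hCpos, hε, fun a b ha hb => ⟨?_, ?_, fun p hp hpM => ?_⟩⟩
  · refine (typeI_votingRule_le h0 ht0 ht1).trans (ENNReal.ofReal_le_ofReal ?_)
    rw [two_pow_mul_exp_div_pow _ _ hsc]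
    gcongr
    exact le_max_left _ _
  · refine (typeII_votingRule_le h1 ht0 ht1).trans (ENNReal.ofReal_le_ofReal ?_)
    rw [two_pow_mul_exp_div_pow _ _ hsc]
    gcongr
    exact le_max_right _ _
  · exact hlog p _ _ hp (one_le_delay _) hpM (hD a b ha hb)

end VotingRule

/-! ### Passage to the limit -/

theorem tendsto_ofReal_mul_exp_neg {κ C : ℝ} (hκ : 0 < κ) :
    Tendsto (fun a : ℝ => ENNReal.ofReal (C * Real.exp (-κ * a))) atTop (𝓝 0) := by
  have h : Tendsto (fun a : ℝ => Real.exp (-κ * a)) atTop (𝓝 0) :=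
    Real.tendsto_exp_atBot.comp (tendsto_id.const_mul_atTop_of_neg (neg_neg_of_pos hκ))
  simpa using ENNReal.tendsto_ofReal (h.const_mul C)

theorem EReal.coe_le_of_forall_nonneg_lt {x : ℝ} {y : EReal} (hx : 0 < x)
    (h : ∀ q : ℝ, 0 ≤ q → q < x → (q : EReal) ≤ y) : (x : EReal) ≤ y := by
  refine le_of_forall_lt fun z hz => ?_
  obtain ⟨q, hzq, hqx⟩ := EReal.lt_iff_exists_real_btwn.1 hz
  refine hzq.trans_le (le_trans ?_ (h (max q 0) (le_max_right _ _)
    (max_lt (EReal.coe_lt_coe_iff.1 hqx) hx)))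
  exact EReal.coe_le_coe_iff.2 (le_max_left _ _)

end ByzDet

open ByzDet in
theorem theorem2 {Ξ : Type*} [MeasurableSpace Ξ]
    (μ ν : Measure ℝ) [IsProbabilityMeasure μ] [IsProbabilityMeasure ν]
    (hμν : μ ≪ ν) (hνμ : ν ≪ μ)
    (hint1 : Integrable (llr μ ν) μ) (hint0 : Integrable (llr μ ν) ν)
    (hI1 : 0 < ByzDet.klOne μ ν) (hI0 : 0 < ByzDet.klZero μ ν)
    (s c : ℕ) (hsc : 2 * c < s)
    (ρ : Measure Ξ) [IsProbabilityMeasure ρ] (g : ByzDet.Attack s c Ξ) :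
    -- the bound for `γ(f^(s-c), g)`
    (((((s : ℝ) - 2 * c) * min (ByzDet.klZero μ ν) (ByzDet.klOne μ ν) : ℝ) : EReal) ≤
      ByzDet.gamma μ ν ρ g (ByzDet.votingRule μ ν s (s - c))) ∧
    -- with equal thresholds `a = b → ∞`, both error probabilities tend to zero,
    (Tendsto (fun a : ℝ => ByzDet.typeI μ ν ρ g (ByzDet.votingRule μ ν s (s - c) a a))
      atTop (𝓝 0)) ∧
    (Tendsto (fun a : ℝ => ByzDet.typeII μ ν ρ g (ByzDet.votingRule μ ν s (s - c) a a))
      atTop (𝓝 0)) ∧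
    -- and the same bound holds for the larger one
    (((((s : ℝ) - 2 * c) * min (ByzDet.klZero μ ν) (ByzDet.klOne μ ν) : ℝ) : EReal) ≤
      ByzDet.gammaEqualThresholds μ ν ρ g (ByzDet.votingRule μ ν s (s - c))) := by
  have h1 := isLLRIncrement_llr hμν hνμ hint1 hI1
  have h0 := isLLRIncrement_neg_llr hμν hνμ hint0 hI0
  have hpos : 0 < ((s : ℝ) - 2 * c) * min (klZero μ ν) (klOne μ ν) := by
    have : (2 * c : ℝ) < s := by exact_mod_cast hsc
    exact mul_pos (by linarith) (lt_min hI0 hI1)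
  have hev : ∀ᶠ a : ℝ in atTop, 0 < a := eventually_gt_atTop 0
  -- The rate `q = 0` suffices here: only the exponential decay of the errors is used.
  obtain ⟨κ, C, _, hκ, _, _, hb⟩ := exists_error_bounds (ρ := ρ) (g := g) h1 h0 hsc le_rfl hpos
  have hI : Tendsto (fun a : ℝ => typeI μ ν ρ g (votingRule μ ν s (s - c) a a)) atTop (𝓝 0) :=
    tendsto_of_tendsto_of_tendsto_of_le_of_le' tendsto_const_nhds
      (tendsto_ofReal_mul_exp_neg hκ) (.of_forall fun _ => zero_le)
      (hev.mono fun a ha => (hb a a ha ha).1)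
  have hII : Tendsto (fun a : ℝ => typeII μ ν ρ g (votingRule μ ν s (s - c) a a)) atTop (𝓝 0) :=
    tendsto_of_tendsto_of_tendsto_of_le_of_le' tendsto_const_nhds
      (tendsto_ofReal_mul_exp_neg hκ) (.of_forall fun _ => zero_le)
      (hev.mono fun a ha => (hb a a ha ha).2.1)
  refine ⟨?_, hI, hII, ?_⟩
  · refine EReal.coe_le_of_forall_nonneg_lt hpos fun q hq0 hq => ?_
    obtain ⟨κ, C, ε, -, -, hε, hb⟩ := exists_error_bounds (ρ := ρ) (g := g) h1 h0 hsc hq0 hq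
    refine le_liminf_of_le (by isBoundedDefault) ?_
    have hsmall : ∀ᶠ t : ℝ × ℝ in comap (fun t : ℝ × ℝ =>
        typeI μ ν ρ g (votingRule μ ν s (s - c) t.1 t.2)) (𝓝[>] 0),
        typeI μ ν ρ g (votingRule μ ν s (s - c) t.1 t.2) ≤ ε :=
      tendsto_comap.eventually
        (mem_nhdsWithin_of_mem_nhds (Iic_mem_nhds hε))
    filter_upwards [hsmall.filter_mono inf_le_left, mem_inf_of_right (mem_principal_self _)]
      with t ht htm
    obtain ⟨ha, hb', heq⟩ := htm
    obtain ⟨hα, hβ, hlog⟩ := hb t.1 t.2 ha hb'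
    refine hlog _ ht ?_
    -- `β` decays in `a` and `α` in `b`. Since they are equal, the bound with the larger threshold
    -- applies to both.
    rcases max_choice t.1 t.2 with h | h <;> rw [h]
    · rw [heq]
      exact hβ
    · exact hα
  · refine EReal.coe_le_of_forall_nonneg_lt hpos fun q hq0 hq => ?_
    obtain ⟨κ, C, ε, -, -, hε, hb⟩ := exists_error_bounds (ρ := ρ) (g := g) h1 h0 hsc hq0 hq
    refine le_liminf_of_le (by isBoundedDefault) ?_
    filter_upwards [hev, hI.eventually (Iio_mem_nhds hε), hII.eventually (Iio_mem_nhds hε)]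
      with a ha h2 h3
    obtain ⟨hα, hβ, hlog⟩ := hb a a ha ha
    refine hlog _ (max_le h2.le h3.le) ?_
    rw [max_self]
    exact max_le hα hβ
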